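/- **Setting.** Let $\mathcal P$ be a compact metric space and $\Omega$ a compact set in $\mathbb C^d$ (with the maximum norm), and let $h:\mathcal P\times\Omega\to\mathbb C$, $h_p=h(p,\cdot)$, be bounded, not identically zero, and such that $\|h_{p_i}-h_p\|_\infty\to0$ whenever $p_i\to p$; here $\|\cdot\|_\infty$ is the supremum norm. **Magic points.** Put $I_0(h)=0$. For $M=1,2,\dots$, as long as $\{h_p\}$ contains at least $M$ linearly independent functions, choose $p_M^*\in\arg\max_{p}\|h_p-I_{M-1}(h)(p,\cdot)\|_\infty$, then, with $r_M=h_{p_M^*}-I_{M-1}(h)(p_M^*,\cdot)$, choose $z_M^*\in\arg\max_{z\in\Omega}|r_M(z)|$ and set $q_M=r_M/r_M(z_M^*)$. With $B^M=(q_m(z_j^*))_{j,m\le M}$ and $\theta^M_m=\sum_{j=1}^M (B^M)^{-1}_{jm}q_j$, define $I_M(h)(p,z)=\sum_{m=1}^M h_p(z_m^*)\,\theta_m^M(z)$. If the procedure has stopped after $N<M$ steps, put $I_M(h)=I_N(h)$. For a finite measure $\mu$ on $\Omega$ (with respect to any $\sigma$-algebra) such that every $h_p$ is measurable, put $\mathcal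 I(h_p,\mu)=\int_\Omega h_p\,d\mu$ and $\mathcal I_M(h,\mu)(p)=\int_\Omega I_M(h)(p,z)\,\mu(dz)$. **Bernstein ellipses.** For $\varrho>1$ let $B([-1,1],\varrho)$ be the open region bounded by the ellipse with foci $\pm1$ whose semi-axes sum to $\varrho$. For $S\subset\mathbb R$ compact and non-empty, let $B(S,\varrho)$ be the image of $B([-1,1],\varrho)$ under $x\mapsto \frac{\inf S+\sup S}2+\frac{\sup S-\inf S}2\,x$. **Theorem.** Let $\varrho>4$ and let one of the following hold. (a) $\Omega\subset\mathbb R$, and $h_p(z)=f_1(p,z)f_2(z)$ on $\mathcal P\times\Omega$ with functions $f_2:\Omega\to\mathbb C$ and $f_1:\mathcal P\times B(\Omega,\varrho)\to\mathbb C$ such that $f_1(p,\cdot)$ is analytic in the interior of $B(\Omega,\varrho)$ for each $p\in\mathcal P$, and $C_1:=\sup_{\mathcal P\times B(\Omega,\varrho)}|f_1|\,\sup_\Omega|f_2|<\infty$. (b) $\mathcal P\subset\mathbb R$, and $h_p(z)=f_1(p,z)f_2(z)$ on $\mathcal P\times\Omega$ with functions $f_2:\Omega\to\mathbb C$ and $f_1:B(\mathcal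 P,\varrho)\times\Omega\to\mathbb C$ such that $f_1(\cdot,z)$ is analytic in the interior of $B(\mathcal P,\varrho)$ for each $z\in\Omega$, and $C_1:=\sup_{B(\mathcal P,\varrho)\times\Omega}|f_1|\,\sup_\Omega|f_2|<\infty$. Then, with the constant $$C=\frac{2\varrho}{\varrho-1}\,C_1>0,$$ for all $M\ge1$ for which the first $M$ steps can be performed (that is, the maximisers required up to step $M$, or up to the stopping of the procedure, exist), whatever choice is made among several maximisers, and for all finite measures $\mu$ as above, $$\|h-I_M(h)\|_\infty=\sup_{p\in\mathcal P,\,z\in\Omega}|h_p(z)-I_M(h)(p,z)|\le C\,M\,(\varrho/4)^{-M},$$ $$\sup_{p\in\mathcal P}\bigl|\mathcal I(h_p,\mu)-\mathcal I_M(h,\mu)(p)\bigr|\le C\,\mu(\Omega)\,M\,(\varrho/4)^{-M},$$ and all integrands here are integrable. -/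

import Mathlib

open Filter Topology MeasureTheory
open scoped ENNReal

noncomputable section

/-! ### Magic point empirical interpolation

Steps are counted from `0`: `p m`, `z m`, `q m` are the objects chosen in step `m + 1`. -/

/-- The standing assumptions on a family `h p : Ω → ℂ`: compactness of both sets, boundedness,
sequential continuity of `p ↦ h p` in the supremum norm, and `h` is not identically zero. -/
structure MagicAssumptions {P Ω : Type*} [TopologicalSpace P] [TopologicalSpace Ω]
    (h : P → Ω → ℂ) : Prop where
  compact_param : CompactSpace P
  compact_domain : CompactSpace Ω
  bounded : ∃ K : ℝ, ∀ p x, ‖h p x‖ ≤ K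
  seqCont : ∀ (u : ℕ → P) (p : P), Tendsto u atTop (𝓝 p) →
    TendstoUniformly (fun i => h (u i)) (h p) atTop
  nonzero : ∃ p x, h p x ≠ 0

/-- The matrix `B^M` with entries `B_{jm} = q_m(z_j)`. -/
def magicMatrix {Ω : Type*} (q : ℕ → Ω → ℂ) (z : ℕ → Ω) (M : ℕ) : Matrix (Fin M) (Fin M) ℂ :=
  Matrix.of fun j m => q m (z j)

/-- The functions `θ_m^M = ∑_j (B^M)⁻¹_{jm} q_j`. -/
def magicTheta {Ω : Type*} (q : ℕ → Ω → ℂ) (z : ℕ → Ω) (M : ℕ) (m : Fin M) (x : Ω) : ℂ :=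
  ∑ j : Fin M, (magicMatrix q z M)⁻¹ j m * q j x

/-- The interpolant `∑_{m ≤ M} h_p(z_m) θ_m^M(x)` built from `M` points and basis functions.
It is zero for `M = 0`. -/
def magicSum {P Ω : Type*} (h : P → Ω → ℂ) (z : ℕ → Ω) (q : ℕ → Ω → ℂ) (M : ℕ)
    (p : P) (x : Ω) : ℂ :=
  ∑ m : Fin M, h p (z m) * magicTheta q z M m x

/-- The residual after `m` steps. -/
def magicResidual {P Ω : Type*} (h : P → Ω → ℂ) (z : ℕ → Ω) (q : ℕ → Ω → ℂ) (m : ℕ)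
    (p : P) (x : Ω) : ℂ :=
  h p x - magicSum h z q m p x

/-- There are at least `k` linearly independent functions among the `h p`. -/
def HasIndependent {P Ω : Type*} (h : P → Ω → ℂ) (k : ℕ) : Prop :=
  ∃ s : Fin k → P, LinearIndependent ℂ (fun i => h (s i))

/-- `p`, `z`, `q` are magic parameters, magic points and basis functions produced by the first
`M` steps of the greedy procedure (with any choice among several maximisers). A step is carried
out only as long as there are enough linearly independent functions in the family. In the
first step the residual is `h` itself. -/
def IsMagicRun {P Ω : Type*} (h : P → Ω → ℂ) (M : ℕ)
    (p : ℕ → P) (z : ℕ → Ω) (q : ℕ → Ω → ℂ) : Prop :=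
  ∀ m < M, HasIndependent h (m + 1) →
    (∀ p' : P, (⨆ x, ‖magicResidual h z q m p' x‖) ≤ ⨆ x, ‖magicResidual h z q m (p m) x‖) ∧
    (∀ x : Ω, ‖magicResidual h z q m (p m) x‖ ≤ ‖magicResidual h z q m (p m) (z m)‖) ∧
    (∀ x : Ω, q m x =
      magicResidual h z q m (p m) x / magicResidual h z q m (p m) (z m))

open Classical in
/-- The number of steps carried out when `M` steps are asked for: the minimum of `M` and the
dimension of the span of the family. -/
def magicSteps {P Ω : Type*} (h : P → Ω → ℂ) (M : ℕ) : ℕ :=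
  Nat.findGreatest (HasIndependent h) M

/-- The magic point interpolation `I_M(h)(p, x)`. If the procedure has stopped before step `M`,
this is the interpolation from all the steps that were carried out. -/
def magicInterp {P Ω : Type*} (h : P → Ω → ℂ) (z : ℕ → Ω) (q : ℕ → Ω → ℂ) (M : ℕ)
    (p : P) (x : Ω) : ℂ :=
  magicSum h z q (magicSteps h M) p x

/-! ### Bernstein ellipses -/

/-- The open region bounded by the ellipse with foci `±1` whose semi-axes `a > b` satisfy
`a + b = ϱ`. As `a ^ 2 - b ^ 2 = 1`, the sum of the distances to the foci on the ellipse is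
`2 * a = ϱ + ϱ⁻¹`. -/
def stdBernsteinEllipse (ϱ : ℝ) : Set ℂ :=
  {w | ‖w - 1‖ + ‖w + 1‖ < ϱ + ϱ⁻¹}

/-- The transform `τ` that maps `[-1, 1]` onto `[b₁, b₂]`. -/
def bernsteinTransform (b₁ b₂ : ℝ) (w : ℂ) : ℂ :=
  (b₂ : ℂ) + ((b₁ : ℂ) - b₂) / 2 * (1 - (w.re : ℂ)) + Complex.I * (((b₂ : ℂ) - b₁) / 2 * w.im)

/-- The generalized Bernstein ellipse `B(S, ϱ) = B([inf S, sup S], ϱ)` of a set of reals. -/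
def bernsteinEllipse (S : Set ℝ) (ϱ : ℝ) : Set ℂ :=
  bernsteinTransform (sInf S) (sSup S) '' stdBernsteinEllipse ϱ

/-! ### The analytic property -/

/-- The analytic property of `h(p, x)` with respect to `X` in the argument `x`, witnessed by
`h(p, x) = f₁(p, x) f₂(x)` with `f₁` extended to `P × X`. A bounded factor that depends on `p`
only needs no place of its own: it can be merged into `f₁`. -/
structure AnalyticFactorizationSecond {P : Type*} {Ω : Set ℝ} (h : P → Ω → ℂ) (X : Set ℂ)
    (f₁ : P → ℂ → ℂ) (f₂ : Ω → ℂ) : Prop where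
  subset : ∀ x : Ω, (((x : ℝ) : ℂ)) ∈ X
  factor : ∀ (p : P) (x : Ω), h p x = f₁ p ((x : ℝ) : ℂ) * f₂ x
  analytic : ∀ p : P, AnalyticOnNhd ℂ (f₁ p) (interior X)
  finite : (⨆ p : P, ⨆ w ∈ X, ‖f₁ p w‖ₑ) * (⨆ x : Ω, ‖f₂ x‖ₑ) < ∞

/-- The analytic property of `h(p, x)` with respect to `X` in the argument `p`, witnessed by
`h(p, x) = f₁(p, x) f₂(x)` with `f₁` extended to `X × Ω`. -/
structure AnalyticFactorizationFirst {P : Set ℝ} {Ω : Type*} (h : P → Ω → ℂ) (X : Set ℂ)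
    (f₁ : ℂ → Ω → ℂ) (f₂ : Ω → ℂ) : Prop where
  subset : ∀ p : P, (((p : ℝ) : ℂ)) ∈ X
  factor : ∀ (p : P) (x : Ω), h p x = f₁ ((p : ℝ) : ℂ) x * f₂ x
  analytic : ∀ x : Ω, AnalyticOnNhd ℂ (fun w => f₁ w x) (interior X)
  finite : (⨆ w ∈ X, ⨆ x : Ω, ‖f₁ w x‖ₑ) * (⨆ x : Ω, ‖f₂ x‖ₑ) < ∞

/-- The explicit constant: `2 ϱ / (ϱ - 1)` times `sup |f₁| sup |f₂|`. -/
def magicConst (ϱ : ℝ) (s₁ s₂ : ℝ≥0∞) : ℝ :=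
  2 * ϱ / (ϱ - 1) * (s₁ * s₂).toReal

/-- The two error bounds with constant `C`: for every `M ≥ 1` and every run of `M` steps of the
procedure, the interpolation error is at most `C M (ϱ/4)^{-M}` everywhere, and for every finite
measure on `Ω` for which the integrands are measurable, the integration error is at most
`C μ(Ω) M (ϱ/4)^{-M}` for all parameters. -/
def MagicErrorBounds {P Ω : Type*} (h : P → Ω → ℂ) (ϱ C : ℝ) : Prop :=
  ∀ (M : ℕ), 1 ≤ M → ∀ (p : ℕ → P) (z : ℕ → Ω) (q : ℕ → Ω → ℂ), IsMagicRun h M p z q →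
    (∀ (p' : P) (x : Ω),
      ‖h p' x - magicInterp h z q M p' x‖ ≤ C * M * (ϱ / 4) ^ (-(M : ℤ))) ∧
    (∀ (_ : MeasurableSpace Ω) (μ : Measure Ω), IsFiniteMeasure μ →
      (∀ p' : P, AEStronglyMeasurable (h p') μ) →
      ∀ p' : P, Integrable (h p') μ ∧ Integrable (magicInterp h z q M p') μ ∧
        ‖(∫ x, h p' x ∂μ) - ∫ x, magicInterp h z q M p' x ∂μ‖
          ≤ C * μ.real Set.univ * M * (ϱ / 4) ^ (-(M : ℤ)))

end

/-! ### Chebyshev expansion on a Bernstein ellipse -/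

/-! The error is controlled in two independent stages: rank-`M` approximation of `h`, and comparison
of the greedy interpolant with an arbitrary rank-`M` approximation.

Approximation: a function bounded by `K` and analytic on the ellipse has Chebyshev coefficients of
size at most `2 * K * ϱ⁻¹ ^ k`, since the substitution `w = (u + u⁻¹) / 2` turns them into Laurent
coefficients on the annulus `ϱ⁻¹ < ‖u‖ < ϱ`. Truncation after `M` terms costs `2 * ϱ / (ϱ - 1) * K *
ϱ⁻¹ ^ M` (`norm_sub_chebyshev_sum_le`). Expanding in `z` or in `p` separates the variables in either
case, so both cases end in `magicErrorBounds_of_lowRank`.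

Comparison (`IsGreedyBasis.norm_residual_le`): if `h` is within `δ` of rank `M`, the residual after
`M` greedy steps is at most `2 * 4 ^ M * δ`. A functional supported on the `M` magic points and one
further point annihilates the approximants, so it is small on every `h p`; triangularity of `q m (z
k)` turns this into a bound on the residual at the further point. One factor `2 ^ M` comes from the
recursion for the residuals, the other from back substitution.

The factor `2` is absorbed by `M` when `M ≥ 2`. For `M = 1` a direct argument gives `4 * δ`, using
that the zeroth Chebyshev polynomial is constant. If the procedure stops early, the residual
vanishes identically. -/

theorem joukowski_mem_stdBernsteinEllipse {ϱ : ℝ} {u : ℂ} (hϱ : 1 < ϱ)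
    (h₁ : ϱ⁻¹ < ‖u‖) (h₂ : ‖u‖ < ϱ) : (u + u⁻¹) / 2 ∈ stdBernsteinEllipse ϱ := by
  have hϱ0 : 0 < ϱ := by linarith
  have hu : 0 < ‖u‖ := (inv_pos.2 hϱ0).trans h₁
  have hu0 : u ≠ 0 := norm_pos_iff.1 hu
  have e₁ : (u + u⁻¹) / 2 - 1 = (u - 1) ^ 2 / (2 * u) := by field_simp; ring
  have e₂ : (u + u⁻¹) / 2 + 1 = (u + 1) ^ 2 / (2 * u) := by field_simp; ring
  have hpar := parallelogram_law_with_norm ℝ u 1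
  rw [norm_one] at hpar
  -- By the parallelogram law, the sum of the distances to the foci depends on `‖u‖` only: circles
  -- go to confocal ellipses.
  have hsum : ‖(u + u⁻¹) / 2 - 1‖ + ‖(u + u⁻¹) / 2 + 1‖ = ‖u‖ + ‖u‖⁻¹ := by
    rw [e₁, e₂, norm_div, norm_div, norm_pow, norm_pow, norm_mul, Complex.norm_ofNat]
    field_simp
    linarith
  rw [stdBernsteinEllipse, Set.mem_ofPred_eq, hsum]
  have h₃ : 1 < ϱ * ‖u‖ := by
    have := mul_lt_mul_of_pos_left h₁ hϱ0
    rwa [mul_inv_cancel₀ hϱ0.ne'] at this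
  have : ϱ + ϱ⁻¹ - (‖u‖ + ‖u‖⁻¹) = (ϱ - ‖u‖) * (ϱ * ‖u‖ - 1) / (ϱ * ‖u‖) := by
    field_simp; ring
  have : 0 < (ϱ - ‖u‖) * (ϱ * ‖u‖ - 1) / (ϱ * ‖u‖) := by
    have : 0 < ϱ - ‖u‖ := by linarith
    have : 0 < ϱ * ‖u‖ - 1 := by linarith
    positivity
  linarith

theorem ofReal_mem_stdBernsteinEllipse {ϱ t : ℝ} (hϱ : 1 < ϱ) (h₁ : -1 ≤ t) (h₂ : t ≤ 1) :
    (t : ℂ) ∈ stdBernsteinEllipse ϱ := by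
  have e₁ : (t : ℂ) - 1 = ((t - 1 : ℝ) : ℂ) := by push_cast; ring
  have e₂ : (t : ℂ) + 1 = ((t + 1 : ℝ) : ℂ) := by push_cast; ring
  rw [stdBernsteinEllipse, Set.mem_ofPred_eq, e₁, e₂, Complex.norm_real, Complex.norm_real,
    Real.norm_of_nonpos (by linarith), Real.norm_of_nonneg (by linarith)]
  have hϱ0 : 0 < ϱ := by linarith
  have : ϱ + ϱ⁻¹ - 2 = (ϱ - 1) ^ 2 / ϱ := by field_simp; ring
  have : 0 < (ϱ - 1) ^ 2 / ϱ := by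
    have : 0 < ϱ - 1 := by linarith
    positivity
  linarith

theorem isOpen_stdBernsteinEllipse (ϱ : ℝ) : IsOpen (stdBernsteinEllipse ϱ) :=
  isOpen_lt (by fun_prop) continuous_const

/-- The Fourier coefficients of `t ↦ F (cos t)` as integrals along the unit circle. -/
noncomputable def chebyshevFourier (F : ℂ → ℂ) (n : ℤ) : ℂ :=
  (2 * Real.pi * Complex.I : ℂ)⁻¹ • ∮ u in C(0, 1), u ^ (-n - 1) * F ((u + u⁻¹) / 2)

/-- The integrand is analytic in the annulus `ϱ⁻¹ < ‖u‖ < ϱ`, so the unit circle may be deformed to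
the circle of radius `r`, where the integrand is estimated trivially. -/
theorem norm_chebyshevFourier_le_zpow {F : ℂ → ℂ} {K ϱ : ℝ} (hϱ : 1 < ϱ)
    (hF : DifferentiableOn ℂ F (stdBernsteinEllipse ϱ))
    (hK : ∀ w ∈ stdBernsteinEllipse ϱ, ‖F w‖ ≤ K) (n : ℤ) {r : ℝ} (h₁ : ϱ⁻¹ < r) (h₂ : r < ϱ) :
    ‖chebyshevFourier F n‖ ≤ K * r ^ (-n) := by
  have hϱ0 : 0 < ϱ := by linarith
  have hr0 : 0 < r := (inv_pos.2 hϱ0).trans h₁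
  have hinv : ϱ⁻¹ < 1 := inv_lt_one_of_one_lt₀ hϱ
  have hdiff : ∀ u : ℂ, ϱ⁻¹ < ‖u‖ → ‖u‖ < ϱ →
      DifferentiableAt ℂ (fun u : ℂ => u ^ (-n - 1) * F ((u + u⁻¹) / 2)) u := by
    intro u hu₁ hu₂
    have hu0 : u ≠ 0 := norm_pos_iff.1 ((inv_pos.2 hϱ0).trans hu₁)
    have hFd := hF.differentiableAt
      ((isOpen_stdBernsteinEllipse ϱ).mem_nhds (joukowski_mem_stdBernsteinEllipse hϱ hu₁ hu₂))
    have hJ : DifferentiableAt ℂ (fun u : ℂ => (u + u⁻¹) / 2) u :=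
      ((differentiableAt_id.add (differentiableAt_inv hu0)).div_const 2)
    exact (differentiableAt_zpow.2 (Or.inl hu0)).mul (hFd.comp u hJ)
  have key : ∀ a b : ℝ, ϱ⁻¹ < a → a ≤ b → b < ϱ →
      (∮ u in C(0, b), u ^ (-n - 1) * F ((u + u⁻¹) / 2)) =
        ∮ u in C(0, a), u ^ (-n - 1) * F ((u + u⁻¹) / 2) := by
    intro a b ha hab hb
    refine Complex.circleIntegral_eq_of_differentiable_on_annulus_off_countable
      ((inv_pos.2 hϱ0).trans ha) hab Set.countable_empty ?_ ?_
    · intro u hu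
      simp only [Set.mem_sdiff, mem_closedBall_zero_iff, mem_ball_zero_iff, not_lt] at hu
      exact (hdiff u (by linarith) (by linarith)).continuousAt.continuousWithinAt
    · intro u hu
      simp only [Set.mem_sdiff, mem_closedBall_zero_iff, mem_ball_zero_iff, not_le] at hu
      exact hdiff u (by linarith) (by linarith)
  have hshift : (∮ u in C(0, 1), u ^ (-n - 1) * F ((u + u⁻¹) / 2)) =
      ∮ u in C(0, r), u ^ (-n - 1) * F ((u + u⁻¹) / 2) := by
    rcases le_total r 1 with h | h
    · exact key r 1 h₁ h hϱ
    · exact (key 1 r hinv h h₂).symm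
  rw [chebyshevFourier, hshift]
  have hb : ∀ u ∈ Metric.sphere (0 : ℂ) r,
      ‖u ^ (-n - 1) * F ((u + u⁻¹) / 2)‖ ≤ r ^ (-n - 1) * K := by
    intro u hu
    have hu : ‖u‖ = r := by simpa using hu
    rw [norm_mul, norm_zpow, hu]
    gcongr
    exact hK _ (joukowski_mem_stdBernsteinEllipse hϱ (by linarith) (by linarith))
  refine (circleIntegral.norm_two_pi_i_inv_smul_integral_le_of_norm_le_const hr0.le hb).trans_eq ?_
  rw [zpow_sub_one₀ hr0.ne']
  field_simp

/-- `F` is controlled on the open ellipse only, so the bound for radius `r` is passed to the limit: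
`r → ϱ` from below for `n ≥ 0`, and `r → ϱ⁻¹` from above for `n ≤ 0`. -/
theorem norm_chebyshevFourier_le {F : ℂ → ℂ} {K ϱ : ℝ} (hϱ : 1 < ϱ)
    (hF : DifferentiableOn ℂ F (stdBernsteinEllipse ϱ))
    (hK : ∀ w ∈ stdBernsteinEllipse ϱ, ‖F w‖ ≤ K) (n : ℤ) :
    ‖chebyshevFourier F n‖ ≤ K * ϱ⁻¹ ^ n.natAbs := by
  have hϱ0 : 0 < ϱ := by linarith
  have hinv : ϱ⁻¹ < 1 := inv_lt_one_of_one_lt₀ hϱ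
  have hlim : ∀ a : ℝ, a ≠ 0 → Tendsto (fun r : ℝ => K * r ^ (-n)) (𝓝 a) (𝓝 (K * a ^ (-n))) :=
    fun a ha => ((continuousAt_zpow₀ a (-n) (Or.inl ha)).tendsto).const_mul K
  rcases le_total 0 n with h | h
  · have e : ϱ⁻¹ ^ n.natAbs = ϱ ^ (-n) := by
      lift n to ℕ using h
      simp
    rw [e]
    refine ge_of_tendsto (x := 𝓝[<] ϱ) ((hlim ϱ hϱ0.ne').mono_left nhdsWithin_le_nhds) ?_
    filter_upwards [Ioo_mem_nhdsLT (hinv.trans hϱ)] with r hr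
    exact norm_chebyshevFourier_le_zpow hϱ hF hK n hr.1 hr.2
  · have e : ϱ⁻¹ ^ n.natAbs = ϱ⁻¹ ^ (-n) := by
      obtain ⟨k, rfl⟩ := Int.exists_eq_neg_ofNat h
      simp
    rw [e]
    refine ge_of_tendsto (x := 𝓝[>] ϱ⁻¹)
      ((hlim ϱ⁻¹ (inv_pos.2 hϱ0).ne').mono_left nhdsWithin_le_nhds) ?_
    filter_upwards [Ioo_mem_nhdsGT (hinv.trans hϱ)] with r hr
    exact norm_chebyshevFourier_le_zpow hϱ hF hK n hr.1 hr.2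

theorem hasSum_chebyshevFourier {F : ℂ → ℂ} {K ϱ : ℝ} (hϱ : 1 < ϱ)
    (hF : DifferentiableOn ℂ F (stdBernsteinEllipse ϱ))
    (hK : ∀ w ∈ stdBernsteinEllipse ϱ, ‖F w‖ ≤ K) (t : ℝ) :
    HasSum (fun n : ℤ => chebyshevFourier F n * Complex.exp (n * t * Complex.I))
      (F (Real.cos t)) := by
  have hϱ0 : 0 < ϱ := by linarith
  have hinv : ϱ⁻¹ < 1 := inv_lt_one_of_one_lt₀ hϱ
  have : Fact (0 < 2 * Real.pi) := ⟨Real.two_pi_pos⟩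
  have hcircle : ∀ s : ℝ, (AddCircle.toCircle (s : AddCircle (2 * Real.pi)) : ℂ)
      = Complex.exp (s * Complex.I) := by
    intro s
    rw [AddCircle.toCircle_apply_mk, div_self Real.two_pi_pos.ne', one_mul, Circle.coe_exp]
  have hre : ∀ u : Circle, (((u : ℂ).re : ℝ) : ℂ) ∈ stdBernsteinEllipse ϱ := fun u => by
    have := abs_le.1 (Complex.abs_re_le_norm (u : ℂ))
    rw [Circle.norm_coe] at this
    exact ofReal_mem_stdBernsteinEllipse hϱ this.1 this.2
  -- `F ∘ cos` on the circle, with `cos` written as the real part of a unit complex number. Absolute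
  -- summability of its Fourier coefficients gives pointwise convergence of the series.
  let f : C(AddCircle (2 * Real.pi), ℂ) :=
    ⟨fun x => F (((AddCircle.toCircle x : ℂ).re : ℝ) : ℂ), by
      refine hF.continuousOn.comp_continuous (by fun_prop) fun x => hre _⟩
  have hf : ∀ s : ℝ, f (s : AddCircle (2 * Real.pi)) = F (Real.cos s) := by
    intro s
    change F (((AddCircle.toCircle (s : AddCircle (2 * Real.pi)) : ℂ).re : ℝ) : ℂ) = _
    rw [hcircle, Complex.exp_ofReal_mul_I_re]
  have hfour : ∀ (n : ℤ) (s : ℝ), (fourier n (s : AddCircle (2 * Real.pi)) : ℂ)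
      = Complex.exp (n * s * Complex.I) := by
    intro n s
    rw [fourier_coe_apply]
    congr 1
    have : (Real.pi : ℂ) ≠ 0 := by exact_mod_cast Real.pi_ne_zero
    push_cast
    field_simp
  have hcoeff : ∀ n : ℤ, fourierCoeff f n = chebyshevFourier F n := by
    intro n
    rw [fourierCoeff_eq_intervalIntegral _ _ 0, chebyshevFourier, circleIntegral, zero_add]
    have : ∀ s : ℝ, deriv (circleMap 0 1) s • ((circleMap 0 1 s) ^ (-n - 1) *
        F ((circleMap 0 1 s + (circleMap 0 1 s)⁻¹) / 2)) =
        Complex.I * (fourier (-n) (s : AddCircle (2 * Real.pi)) • f s) := by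
      intro s
      rw [hf, hfour, deriv_circleMap, circleMap_zero, Complex.ofReal_one, one_mul,
        ← Complex.exp_neg, zpow_sub_one₀ (Complex.exp_ne_zero _), ← Complex.exp_int_mul,
        Complex.ofReal_cos, Complex.cos, smul_eq_mul, smul_eq_mul, neg_mul, ← mul_assoc,
        mul_assoc _ (s : ℂ)]
      field_simp
    simp_rw [this]
    rw [intervalIntegral.integral_const_mul]
    have : (Real.pi : ℂ) ≠ 0 := by exact_mod_cast Real.pi_ne_zero
    rw [smul_eq_mul, Complex.real_smul]
    push_cast
    field_simp
  have hsummable : Summable (fourierCoeff f) := by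
    refine Summable.of_norm_bounded (g := fun n : ℤ => K * ϱ⁻¹ ^ n.natAbs) ?_ fun n => ?_
    · refine Summable.mul_left K (Summable.of_nat_of_neg ?_ ?_) <;>
      simpa using summable_geometric_of_lt_one (inv_pos.2 hϱ0).le hinv
    · rw [hcoeff]; exact norm_chebyshevFourier_le hϱ hF hK n
  have := has_pointwise_sum_fourier_series_of_summable hsummable (t : AddCircle (2 * Real.pi))
  simpa only [hcoeff, hfour, hf, smul_eq_mul] using this

/-- The Chebyshev coefficients of `F` on `[-1, 1]`. -/
noncomputable def chebyshevCoeff (F : ℂ → ℂ) (k : ℕ) : ℂ :=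
  if k = 0 then chebyshevFourier F 0 else chebyshevFourier F k + chebyshevFourier F (-k)

theorem norm_chebyshevCoeff_le {F : ℂ → ℂ} {K ϱ : ℝ} (hϱ : 1 < ϱ)
    (hF : DifferentiableOn ℂ F (stdBernsteinEllipse ϱ))
    (hK : ∀ w ∈ stdBernsteinEllipse ϱ, ‖F w‖ ≤ K) (k : ℕ) :
    ‖chebyshevCoeff F k‖ ≤ 2 * K * ϱ⁻¹ ^ k := by
  have h := norm_chebyshevFourier_le hϱ hF hK
  rw [chebyshevCoeff]
  split_ifs with hk
  · subst hk
    have h0 := h 0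
    simp only [Int.natAbs_zero] at h0
    linarith [norm_nonneg (chebyshevFourier F 0)]
  · have h₁ := h k
    have h₂ := h (-k)
    rw [Int.natAbs_neg, Int.natAbs_natCast] at h₂
    rw [Int.natAbs_natCast] at h₁
    linarith [norm_add_le (chebyshevFourier F k) (chebyshevFourier F (-k))]

theorem hasSum_chebyshevCoeff {F : ℂ → ℂ} {K ϱ : ℝ} (hϱ : 1 < ϱ)
    (hF : DifferentiableOn ℂ F (stdBernsteinEllipse ϱ))
    (hK : ∀ w ∈ stdBernsteinEllipse ϱ, ‖F w‖ ≤ K) (t : ℝ) :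
    HasSum (fun k : ℕ => chebyshevCoeff F k * Complex.cos (k * t)) (F (Real.cos t)) := by
  have h₁ := hasSum_chebyshevFourier hϱ hF hK t
  have h₂ := hasSum_chebyshevFourier hϱ hF hK (-t)
  rw [Real.cos_neg] at h₂
  -- Averaging the series at `t` and `-t` replaces exponentials by cosines.
  have h₃ : HasSum (fun n : ℤ => chebyshevFourier F n * Complex.cos (n * t)) (F (Real.cos t)) := by
    have := (h₁.add h₂).div_const 2
    rw [add_self_div_two] at this
    refine this.congr_fun ?_
    intro n
    rw [Complex.cos]
    push_cast
    ring_nf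
  have h₄ := h₃.nat_add_neg
  -- Pairing `n` with `-n` counts the term `n = 0` twice; one copy is removed.
  have h₅ := h₄.sub (hasSum_ite_eq (0 : ℕ) (chebyshevFourier F 0 * Complex.cos ((0 : ℤ) * t)))
  rw [add_sub_cancel_right] at h₅
  refine h₅.congr_fun fun k => ?_
  rw [chebyshevCoeff]
  split_ifs with hk
  · subst hk; simp
  · simp [Complex.cos_neg]; ring

theorem norm_sub_chebyshev_sum_le {F : ℂ → ℂ} {K ϱ : ℝ} (hϱ : 1 < ϱ)
    (hF : DifferentiableOn ℂ F (stdBernsteinEllipse ϱ))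
    (hK : ∀ w ∈ stdBernsteinEllipse ϱ, ‖F w‖ ≤ K) (M : ℕ) (t : ℝ) :
    ‖F (Real.cos t) - ∑ k ∈ Finset.range M, chebyshevCoeff F k * Complex.cos (k * t)‖
      ≤ 2 * ϱ / (ϱ - 1) * K * ϱ⁻¹ ^ M := by
  have hϱ0 : 0 < ϱ := by linarith
  have hinv : ϱ⁻¹ < 1 := inv_lt_one_of_one_lt₀ hϱ
  have h := (hasSum_nat_add_iff' M).2 (hasSum_chebyshevCoeff hϱ hF hK t)
  have hg : HasSum (fun k : ℕ => 2 * K * ϱ⁻¹ ^ M * ϱ⁻¹ ^ k) (2 * K * ϱ⁻¹ ^ M * (1 - ϱ⁻¹)⁻¹) :=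
    (hasSum_geometric_of_lt_one (inv_pos.2 hϱ0).le hinv).mul_left _
  have hle := h.norm_le_of_bounded hg fun k => by
    have hc : Complex.cos (((k + M : ℕ) : ℂ) * t) = ((Real.cos ((k + M : ℕ) * t) : ℝ) : ℂ) := by
      push_cast; rfl
    rw [norm_mul, hc, Complex.norm_real]
    refine (mul_le_of_le_one_right (norm_nonneg _) (Real.abs_cos_le_one _)).trans ?_
    refine (norm_chebyshevCoeff_le hϱ hF hK (k + M)).trans_eq ?_
    ring
  refine hle.trans_eq ?_
  have : ϱ - 1 ≠ 0 := by linarith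
  field_simp

/-! ### The interpolation operator -/

section Interpolation

variable {P Ω : Type*} {h : P → Ω → ℂ} {z : ℕ → Ω} {q : ℕ → Ω → ℂ} {M : ℕ}

theorem det_magicMatrix (hone : ∀ m < M, q m (z m) = 1) (hzero : ∀ m < M, ∀ k < m, q m (z k) = 0) :
    (magicMatrix q z M).det = 1 := by
  rw [Matrix.det_of_isLowerTriangular]
  · exact Finset.prod_eq_one fun i _ => hone i i.2
  · intro i j hij
    exact hzero j j.2 i (by simpa using hij)

theorem magicSum_eq_sum_mulVec (p : P) (x : Ω) : magicSum h z q M p x =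
    ∑ j : Fin M, ((magicMatrix q z M)⁻¹.mulVec fun m : Fin M => h p (z m)) j * q j x := by
  simp only [magicSum, magicTheta, Matrix.mulVec, dotProduct, Finset.mul_sum, Finset.sum_mul]
  rw [Finset.sum_comm]
  exact Finset.sum_congr rfl fun j _ => Finset.sum_congr rfl fun m _ => by ring

theorem magicSum_eq_of_interpolates (hdet : (magicMatrix q z M).det = 1) {p : P} (c : Fin M → ℂ)
    (hc : ∀ k : Fin M, ∑ j : Fin M, q j (z k) * c j = h p (z k)) (x : Ω) :
    magicSum h z q M p x = ∑ j : Fin M, c j * q j x := by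
  have hv : (fun m : Fin M => h p (z m)) = (magicMatrix q z M).mulVec c :=
    funext fun k => (hc k).symm
  rw [magicSum_eq_sum_mulVec, hv, Matrix.mulVec_mulVec,
    Matrix.nonsing_inv_mul _ (by rw [hdet]; exact isUnit_one), Matrix.one_mulVec]

theorem magicSum_apply_point (hdet : (magicMatrix q z M).det = 1) (p : P) {k : ℕ} (hk : k < M) :
    magicSum h z q M p (z k) = h p (z k) := by
  have h₁ : (magicMatrix q z M).mulVec
      ((magicMatrix q z M)⁻¹.mulVec fun m : Fin M => h p (z m)) = fun m : Fin M => h p (z m) := by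
    rw [Matrix.mulVec_mulVec, Matrix.mul_nonsing_inv _ (by rw [hdet]; exact isUnit_one),
      Matrix.one_mulVec]
  rw [magicSum_eq_sum_mulVec, ← congrFun h₁ ⟨k, hk⟩, Matrix.mulVec, dotProduct]
  exact Finset.sum_congr rfl fun j _ => mul_comm _ _

theorem magicResidual_apply_point (hdet : (magicMatrix q z M).det = 1) (p : P) {k : ℕ}
    (hk : k < M) : magicResidual h z q M p (z k) = 0 := by
  rw [magicResidual, magicSum_apply_point hdet p hk, sub_self]

theorem magicResidual_zero (p : P) (x : Ω) : magicResidual h z q 0 p x = h p x := by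
  simp [magicResidual, magicSum]

/-- Newton's form of interpolation: `q M` vanishes at the earlier points and equals `1` at `z M`, so
adding the right multiple of it interpolates at the new point without disturbing the old ones.
Uniqueness of the interpolant does the rest. -/
theorem magicResidual_succ (hone : ∀ m < M + 1, q m (z m) = 1)
    (hzero : ∀ m < M + 1, ∀ k < m, q m (z k) = 0) (p : P) (x : Ω) :
    magicResidual h z q (M + 1) p x =
      magicResidual h z q M p x - magicResidual h z q M p (z M) * q M x := by
  have hd := det_magicMatrix (M := M) (fun m hm => hone m (by lia)) fun m hm => hzero m (by lia)
  have key := magicSum_eq_of_interpolates (h := h) (p := p) (det_magicMatrix hone hzero)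
    (Fin.snoc (α := fun _ => ℂ) ((magicMatrix q z M)⁻¹.mulVec fun m : Fin M => h p (z m))
      (magicResidual h z q M p (z M))) (fun k => by
        rw [Fin.sum_univ_castSucc]
        simp only [Fin.snoc_castSucc, Fin.snoc_last, Fin.val_castSucc, Fin.val_last]
        simp_rw [mul_comm (q _ _)]
        rw [← magicSum_eq_sum_mulVec]
        rcases (Nat.lt_succ_iff_lt_or_eq.1 k.2) with hk | hk
        · rw [magicSum_apply_point hd p hk, hzero M (by lia) k hk, mul_zero, add_zero]
        · rw [hk, hone M (by lia), mul_one, magicResidual]; ring) x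
  rw [Fin.sum_univ_castSucc] at key
  simp only [Fin.snoc_castSucc, Fin.snoc_last, Fin.val_castSucc, Fin.val_last] at key
  rw [← magicSum_eq_sum_mulVec] at key
  rw [magicResidual, key]
  simp only [magicResidual]
  ring

/-- Needed because a real `⨆` over an unbounded family takes the default value `0`; boundedness
makes the suprema in `IsMagicRun` genuine. -/
theorem exists_bound_magicResidual (hh : ∃ K : ℝ, ∀ p x, ‖h p x‖ ≤ K)
    (hq : ∀ m < M, ∀ x, ‖q m x‖ ≤ 1) (p : P) :
    ∃ K : ℝ, ∀ x, ‖magicResidual h z q M p x‖ ≤ K := by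
  obtain ⟨K, hK⟩ := hh
  refine ⟨K + ∑ j : Fin M, ‖((magicMatrix q z M)⁻¹.mulVec fun m : Fin M => h p (z m)) j‖,
    fun x => ?_⟩
  rw [magicResidual, magicSum_eq_sum_mulVec]
  refine (norm_sub_le _ _).trans (add_le_add (hK p x) ((norm_sum_le _ _).trans ?_))
  refine Finset.sum_le_sum fun j _ => ?_
  rw [norm_mul]
  exact mul_le_of_le_one_right (norm_nonneg _) (hq j j.2 x)

theorem HasIndependent.mono {k l : ℕ} (hl : HasIndependent h l) (hkl : k ≤ l) :
    HasIndependent h k := by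
  obtain ⟨s, hs⟩ := hl
  exact ⟨s ∘ Fin.castLE hkl, hs.comp _ (Fin.castLE_injective hkl)⟩

/-- Otherwise every `h p` lies in the span of the `M` functions `magicTheta q z M m`, which has no
room for `M + 1` independent ones. Hence each step that is carried out divides by a nonzero number.
-/
theorem exists_magicResidual_ne_zero (hind : HasIndependent h (M + 1)) :
    ∃ p x, magicResidual h z q M p x ≠ 0 := by
  by_contra! hall
  obtain ⟨s, hs⟩ := hind
  have hmem : ∀ i, h (s i) ∈ Submodule.span ℂ (Set.range fun m : Fin M => magicTheta q z M m) := by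
    intro i
    have : h (s i) = ∑ m : Fin M, h (s i) (z m) • magicTheta q z M m := by
      ext x
      rw [sub_eq_zero.1 (hall (s i) x)]
      simp [magicSum]
    rw [this]
    exact Submodule.sum_mem _ fun m _ => Submodule.smul_mem _ _ (Submodule.subset_span ⟨m, rfl⟩)
  have h₁ : LinearIndependent ℂ (fun i => (⟨h (s i), hmem i⟩ :
      Submodule.span ℂ (Set.range fun m : Fin M => magicTheta q z M m))) :=
    LinearIndependent.of_comp (Submodule.subtype _) hs
  have := FiniteDimensional.span_of_finite ℂ
    (Set.finite_range fun m : Fin M => magicTheta q z M m)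
  have h₂ := h₁.fintype_card_le_finrank
  have h₃ := finrank_range_le_card (R := ℂ) fun m : Fin M => magicTheta q z M m
  rw [Set.finrank] at h₃
  simp only [Fintype.card_fin] at h₂ h₃
  lia

/-- The properties of a greedy run whose `M` steps have all been carried out. -/
structure IsGreedyBasis (h : P → Ω → ℂ) (M : ℕ) (p : ℕ → P) (z : ℕ → Ω) (q : ℕ → Ω → ℂ) :
    Prop where
  one : ∀ m < M, q m (z m) = 1
  zero : ∀ m < M, ∀ k < m, q m (z k) = 0
  norm_le : ∀ m < M, ∀ x, ‖q m x‖ ≤ 1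
  ne_zero : ∀ m < M, magicResidual h z q m (p m) (z m) ≠ 0
  max : ∀ m < M, ∀ p' x,
    ‖magicResidual h z q m p' x‖ ≤ ‖magicResidual h z q m (p m) (z m)‖
  eq_div : ∀ m < M, ∀ x,
    q m x = magicResidual h z q m (p m) x / magicResidual h z q m (p m) (z m)

namespace IsGreedyBasis

variable {p : ℕ → P}

theorem mono {N : ℕ} (H : IsGreedyBasis h M p z q) (hN : N ≤ M) : IsGreedyBasis h N p z q where
  one m hm := H.one m (hm.trans_le hN)
  zero m hm := H.zero m (hm.trans_le hN)
  norm_le m hm := H.norm_le m (hm.trans_le hN)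
  ne_zero m hm := H.ne_zero m (hm.trans_le hN)
  max m hm := H.max m (hm.trans_le hN)
  eq_div m hm := H.eq_div m (hm.trans_le hN)

theorem residual_point (H : IsGreedyBasis h M p z q) (p' : P) {k : ℕ} (hk : k < M) :
    magicResidual h z q M p' (z k) = 0 :=
  magicResidual_apply_point (det_magicMatrix H.one H.zero) p' hk

theorem residual_succ (H : IsGreedyBasis h M p z q) {m : ℕ} (hm : m < M) (p' : P) (x : Ω) :
    magicResidual h z q (m + 1) p' x =
      magicResidual h z q m p' x - magicResidual h z q m p' (z m) * q m x :=
  magicResidual_succ (H.mono hm).one (H.mono hm).zero p' x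

theorem residual_param (H : IsGreedyBasis h M p z q) {i m : ℕ} (him : i < m) (hm : m ≤ M)
    (x : Ω) : magicResidual h z q m (p i) x = 0 := by
  induction m, him using Nat.le_induction generalizing x with
  | base =>
    rw [H.residual_succ hm, H.eq_div i hm, mul_div_cancel₀ _ (H.ne_zero i hm), sub_self]
  | succ m _ ih =>
    rw [H.residual_succ hm, ih (by lia), ih (by lia), zero_mul, sub_self]

theorem of_isMagicRun (hh : ∃ K : ℝ, ∀ p x, ‖h p x‖ ≤ K) (hrun : IsMagicRun h M p z q)
    {N : ℕ} (hNM : N ≤ M) (hind : HasIndependent h N) : IsGreedyBasis h N p z q := by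
  induction N with
  | zero => exact ⟨by lia, by lia, by lia, by lia, by lia, by lia⟩
  | succ N ih =>
    have H := ih (by lia) (hind.mono (by lia))
    obtain ⟨hsup, hpt, hq⟩ := hrun N hNM hind
    have hmax : ∀ p' x, ‖magicResidual h z q N p' x‖ ≤ ‖magicResidual h z q N (p N) (z N)‖ := by
      intro p' x
      have : Nonempty Ω := ⟨x⟩
      obtain ⟨K, hK⟩ := exists_bound_magicResidual (z := z) hh H.norm_le p'
      have hbdd : BddAbove (Set.range fun x => ‖magicResidual h z q N p' x‖) :=
        ⟨K, by rintro _ ⟨y, rfl⟩; exact hK y⟩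
      exact (le_ciSup hbdd x).trans ((hsup p').trans (ciSup_le hpt))
    have hne : magicResidual h z q N (p N) (z N) ≠ 0 := by
      obtain ⟨p', x, hx⟩ := exists_magicResidual_ne_zero (z := z) (q := q) hind
      intro h0
      have := hmax p' x
      rw [h0, norm_zero] at this
      exact hx (norm_le_zero_iff.1 this)
    have step : ∀ {Q : ℕ → Prop}, (∀ m < N, Q m) → Q N → ∀ m < N + 1, Q m := by
      intro Q h₁ h₂ m hm
      rcases Nat.lt_succ_iff_lt_or_eq.1 hm with hm | rfl
      exacts [h₁ m hm, h₂]
    refine ⟨step H.one ?_, step H.zero ?_, step H.norm_le ?_, step H.ne_zero hne,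
      step H.max hmax, step H.eq_div hq⟩
    · rw [hq, div_self hne]
    · intro k hk
      rw [hq, H.residual_point _ hk, zero_div]
    · intro x
      rw [hq, norm_div]
      exact div_le_one_of_le₀ (hpt x) (norm_nonneg _)

/-- The residual at `x`, viewed as a linear functional of the interpolated function, kills each
chosen `h (p i)` but not `h p'`. Contrapositively, the residual is zero once the procedure has
stopped. -/
theorem hasIndependent_succ (H : IsGreedyBasis h M p z q) {p' : P} {x : Ω}
    (hx : magicResidual h z q M p' x ≠ 0) : HasIndependent h (M + 1) := by
  suffices hs : ∀ N ≤ M, ∀ p' x, magicResidual h z q N p' x ≠ 0 →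
      LinearIndependent ℂ (Fin.snoc (α := fun _ => Ω → ℂ) (fun i : Fin N => h (p i)) (h p')) by
    refine ⟨Fin.snoc (α := fun _ => P) (fun i : Fin M => p i) p', ?_⟩
    convert hs M le_rfl p' x hx using 1
    ext i : 1
    refine Fin.lastCases ?_ (fun i => ?_) i <;> simp
  intro N
  induction N with
  | zero =>
    intro _ p' x hx
    rw [linearIndependent_finSnoc]
    refine ⟨linearIndependent_empty_type, ?_⟩
    rw [Set.range_eq_empty, Submodule.span_empty, Submodule.mem_bot]
    intro h0
    rw [magicResidual_zero, h0] at hx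
    exact hx rfl
  | succ N ih =>
    intro hN p' x hx
    rw [linearIndependent_finSnoc]
    constructor
    · have e : (fun i : Fin (N + 1) => h (p i)) =
          Fin.snoc (α := fun _ => Ω → ℂ) (fun i : Fin N => h (p i)) (h (p N)) := by
        ext i : 1
        refine Fin.lastCases ?_ (fun i => ?_) i <;> simp
      rw [e]
      exact ih (by lia) (p N) (z N) (H.ne_zero N (by lia))
    · intro hmem
      let T : (Ω → ℂ) →ₗ[ℂ] ℂ :=
        { toFun := fun f => f x - ∑ m : Fin (N + 1), f (z m) * magicTheta q z (N + 1) m x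
          map_add' := fun f g => by
            simp only [Pi.add_apply, add_mul, Finset.sum_add_distrib]; ring
          map_smul' := fun c f => by
            simp only [Pi.smul_apply, smul_eq_mul, mul_assoc, ← Finset.mul_sum, RingHom.id_apply]
            ring }
      have hle : Submodule.span ℂ (Set.range fun i : Fin (N + 1) => h (p i)) ≤ LinearMap.ker T := by
        rw [Submodule.span_le]
        rintro _ ⟨i, rfl⟩
        exact H.residual_param i.2 hN x
      exact hx (hle hmem)

end IsGreedyBasis

end Interpolation

/-! ### Comparison of the greedy error with low rank approximation -/

theorem exists_annihilating_combination {Ω : Type*} (b : ℕ → Ω → ℂ) (y : ℕ → Ω) (M : ℕ) :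
    ∃ c : ℕ → ℂ, (∃ k < M + 1, c k ≠ 0) ∧
      ∀ j < M, ∑ k ∈ Finset.range (M + 1), c k * b j (y k) = 0 := by
  let A : Matrix (Fin M) (Fin (M + 1)) ℂ := Matrix.of fun j k => b j (y k)
  have hker : LinearMap.ker A.mulVecLin ≠ ⊥ :=
    LinearMap.ker_ne_bot_of_finrank_lt (by simp)
  obtain ⟨v, hv, hv0⟩ := Submodule.exists_mem_ne_zero_of_ne_bot hker
  obtain ⟨k, hk⟩ := Function.ne_iff.1 hv0
  have hext : ∀ k : Fin (M + 1), (if hk : (k : ℕ) < M + 1 then v ⟨k, hk⟩ else 0) = v k :=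
    fun k => dif_pos k.2
  refine ⟨fun k => if hk : k < M + 1 then v ⟨k, hk⟩ else 0, ⟨k, k.2, (hext k).trans_ne hk⟩,
    fun j hj => ?_⟩
  rw [Finset.sum_range]
  simp only [hext]
  refine Eq.trans (Finset.sum_congr rfl fun k _ => mul_comm _ _)
    (congrFun (LinearMap.mem_ker.1 hv) ⟨j, hj⟩)

/-- A nonnegative sequence each of whose terms is bounded by `E` plus the sum of the later terms
has total sum at most `2 ^ (M + 1) * E`. -/
theorem sum_le_of_le_add_tail {e : ℕ → ℝ} {E : ℝ} (hE : 0 ≤ E) {M : ℕ}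
    (he : ∀ m ≤ M, e m ≤ E + ∑ k ∈ Finset.Ico (m + 1) (M + 1), e k) :
    ∑ k ∈ Finset.range (M + 1), e k ≤ 2 ^ (M + 1) * E := by
  -- Back substitution: each step towards the front at most doubles the tail sum and adds `E`.
  suffices h : ∀ j ≤ M + 1, ∑ k ∈ Finset.Ico (M + 1 - j) (M + 1), e k ≤ (2 ^ j - 1) * E by
    have := h (M + 1) le_rfl
    rw [Nat.sub_self, ← Finset.range_eq_Ico] at this
    linarith
  intro j
  induction j with
  | zero => simp
  | succ j ih =>
    intro hj
    have h₁ := ih (by lia)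
    have h₂ := he (M + 1 - (j + 1)) (by lia)
    rw [Finset.sum_eq_sum_Ico_succ_bot (by lia)]
    rw [show M + 1 - (j + 1) + 1 = M + 1 - j by lia] at h₂ ⊢
    rw [pow_succ]
    linarith

/-- Tested against a functional `L` that annihilates all `b j`, every `h p'` is small. `L` lives on
the magic points and `x`, so its coefficients can be recovered from the values `L (q m)` and from
`L` of the last residual. -/
theorem IsGreedyBasis.norm_residual_le {P Ω : Type*} {h : P → Ω → ℂ} {M : ℕ} {p : ℕ → P}
    {z : ℕ → Ω} {q : ℕ → Ω → ℂ} (H : IsGreedyBasis h M p z q) {a : ℕ → P → ℂ} {b : ℕ → Ω → ℂ}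
    {δ : ℝ} (happrox : ∀ p' x, ‖h p' x - ∑ j ∈ Finset.range M, a j p' * b j x‖ ≤ δ)
    (p' : P) (x : Ω) : ‖magicResidual h z q M p' x‖ ≤ 2 * 4 ^ M * δ := by
  set r := magicResidual h z q with hr
  have hδ : 0 ≤ δ := (norm_nonneg _).trans (happrox p' x)
  let y : ℕ → Ω := fun k => if k < M then z k else x
  have hy : ∀ k < M, y k = z k := fun k hk => if_pos hk
  have hyM : y M = x := if_neg (lt_irrefl M)
  obtain ⟨c, ⟨k₀, hk₀, hck₀⟩, hc⟩ := exists_annihilating_combination b y M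
  let L : (Ω → ℂ) → ℂ := fun f => ∑ k ∈ Finset.range (M + 1), c k * f (y k)
  set S : ℝ := ∑ k ∈ Finset.range (M + 1), ‖c k‖ with hS
  have hS0 : 0 < S := (norm_pos_iff.2 hck₀).trans_le
    (Finset.single_le_sum (f := fun k => ‖c k‖) (fun _ _ => norm_nonneg _)
      (Finset.mem_range.2 hk₀))
  have hL0 : ∀ p', ‖L (h p')‖ ≤ δ * S := by
    intro p'
    have : L (h p') = ∑ k ∈ Finset.range (M + 1),
        c k * (h p' (y k) - ∑ j ∈ Finset.range M, a j p' * b j (y k)) := by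
      simp only [L, mul_sub, Finset.sum_sub_distrib]
      rw [eq_comm, sub_eq_self]
      simp only [Finset.mul_sum]
      rw [Finset.sum_comm]
      refine Finset.sum_eq_zero fun j hj => ?_
      rw [← mul_zero (a j p'), ← hc j (Finset.mem_range.1 hj), Finset.mul_sum]
      exact Finset.sum_congr rfl fun k _ => by ring
    rw [this, hS, Finset.mul_sum]
    refine (norm_sum_le _ _).trans (Finset.sum_le_sum fun k _ => ?_)
    rw [norm_mul, mul_comm]
    exact mul_le_mul_of_nonneg_right (happrox _ _) (norm_nonneg _)
  have hLq : ∀ m < M, ‖r m (p m) (z m)‖ * ‖L (q m)‖ = ‖L (r m (p m))‖ := by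
    intro m hm
    rw [← norm_mul]
    congr 1
    simp only [L, Finset.mul_sum]
    refine Finset.sum_congr rfl fun k _ => ?_
    rw [H.eq_div m hm]
    have := H.ne_zero m hm
    rw [← hr] at this ⊢
    field_simp
  -- Each recursion step at most doubles the bound: by maximality at `(p m, z m)`, the subtracted
  -- term is no larger under `L` than the residual of `p m`.
  have hL : ∀ m ≤ M, ∀ p', ‖L (r m p')‖ ≤ 2 ^ m * (δ * S) := by
    intro m
    induction m with
    | zero =>
      intro _ p'
      have : r 0 p' = h p' := funext fun x => magicResidual_zero p' x
      rw [this, pow_zero, one_mul]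
      exact hL0 p'
    | succ m ih =>
      intro hm p'
      have e : L (r (m + 1) p') = L (r m p') - r m p' (z m) * L (q m) := by
        simp only [L, Finset.mul_sum, ← Finset.sum_sub_distrib]
        refine Finset.sum_congr rfl fun k _ => ?_
        rw [hr, H.residual_succ hm]
        ring
      have h₁ : ‖r m p' (z m) * L (q m)‖ ≤ ‖L (r m (p m))‖ := by
        rw [norm_mul, ← hLq m hm]
        exact mul_le_mul_of_nonneg_right (H.max m hm _ _) (norm_nonneg _)
      rw [e, pow_succ]
      have := norm_sub_le (L (r m p')) (r m p' (z m) * L (q m))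
      linarith [ih (by lia) p', ih (by lia) (p m)]
  have hdec : ∀ m < M, ∀ k, m ≤ k → k ≤ M → ∀ p' x,
      ‖r k p' x‖ ≤ 2 ^ (k - m) * ‖r m (p m) (z m)‖ := by
    intro m hm k hmk
    induction k, hmk using Nat.le_induction with
    | base => intro _ p' x; simpa using H.max m hm p' x
    | succ k hk ih =>
      intro hkM p' x
      have h₁ := ih (by lia) p' x
      have h₂ := ih (by lia) p' (z k)
      have h₃ : ‖r k p' (z k) * q k x‖ ≤ ‖r k p' (z k)‖ := by
        rw [norm_mul]
        exact mul_le_of_le_one_right (norm_nonneg _) (H.norm_le k hkM x)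
      have h₄ := norm_sub_le (r k p' x) (r k p' (z k) * q k x)
      rw [hr, H.residual_succ hkM, ← hr, show k + 1 - m = k - m + 1 by lia, pow_succ]
      linarith
  set ε : ℝ := ‖r M p' x‖ with hε
  -- For `m < M`, `q m` vanishes at the points before `z m`, so `L (q m)` is `c m` plus a tail; for
  -- `m = M`, the residual vanishes at all magic points and only `c M` times its value at `x`
  -- survives.
  have htail : ∀ m ≤ M, ε * ‖c m‖ ≤
      2 ^ M * (δ * S) + ∑ k ∈ Finset.Ico (m + 1) (M + 1), ε * ‖c k‖ := by
    intro m hm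
    rcases hm.lt_or_eq with hm | rfl
    · have e : L (q m) = c m + ∑ k ∈ Finset.Ico (m + 1) (M + 1), c k * q m (y k) := by
        simp only [L]
        rw [Finset.range_eq_Ico, ← Finset.sum_Ico_consecutive _ (Nat.zero_le m) (by lia),
          Finset.sum_eq_sum_Ico_succ_bot (show m < M + 1 by lia), hy m hm, H.one m hm, mul_one,
          Finset.sum_eq_zero, zero_add]
        intro k hk
        have hk := (Finset.mem_Ico.1 hk).2
        rw [hy k (by lia), H.zero m hm k hk, mul_zero]
      have h₁ : ‖c m‖ ≤ ‖L (q m)‖ + ∑ k ∈ Finset.Ico (m + 1) (M + 1), ‖c k‖ := by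
        rw [eq_sub_of_add_eq e.symm]
        refine (norm_sub_le _ _).trans (add_le_add le_rfl ?_)
        refine (norm_sum_le _ _).trans (Finset.sum_le_sum fun k _ => ?_)
        rw [norm_mul]
        exact mul_le_of_le_one_right (norm_nonneg _) (H.norm_le m hm _)
      have h₂ : ε * ‖L (q m)‖ ≤ 2 ^ M * (δ * S) := calc
        ε * ‖L (q m)‖ ≤ 2 ^ (M - m) * ‖r m (p m) (z m)‖ * ‖L (q m)‖ :=
          mul_le_mul_of_nonneg_right (hdec m hm M hm.le le_rfl p' x) (norm_nonneg _)
        _ = 2 ^ (M - m) * ‖L (r m (p m))‖ := by rw [mul_assoc, hLq m hm]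
        _ ≤ 2 ^ (M - m) * (2 ^ m * (δ * S)) := by gcongr; exact hL m hm.le _
        _ = 2 ^ M * (δ * S) := by rw [← mul_assoc, ← pow_add, Nat.sub_add_cancel hm.le]
      have h₃ := mul_le_mul_of_nonneg_left h₁ (norm_nonneg (r M p' x))
      rw [← hε, mul_add, Finset.mul_sum] at h₃
      linarith
    · rw [Finset.Ico_self, Finset.sum_empty, add_zero]
      refine le_trans (le_of_eq ?_) (hL m le_rfl p')
      simp only [L]
      rw [Finset.sum_range_succ, Finset.sum_eq_zero, zero_add, hyM, norm_mul, mul_comm]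
      intro k hk
      have hk := Finset.mem_range.1 hk
      rw [hy k hk, hr, H.residual_point p' hk, mul_zero]
  have htot := sum_le_of_le_add_tail (by positivity) htail
  rw [← Finset.mul_sum, ← hS] at htot
  refine le_of_mul_le_mul_right (htot.trans_eq ?_) hS0
  rw [show (4 : ℝ) = 2 * 2 by norm_num, mul_pow]
  ring

/-! ### From low rank approximation to the error bounds -/

section ErrorBounds

variable {P Ω : Type*} {h : P → Ω → ℂ}

/-- The greedy error after one step, for a family that is close to multiples of one function
relative to the size of that function. -/
theorem norm_sub_div_mul_le_of_relative {p₀ : P} {z₀ : Ω} (hmax : ∀ p x, ‖h p x‖ ≤ ‖h p₀ z₀‖)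
    (hne : h p₀ z₀ ≠ 0) {a : P → ℂ} {b : Ω → ℂ} {η δ : ℝ}
    (happrox : ∀ p x, ‖h p x - a p * b x‖ ≤ η * ‖b x‖) (hb : ∀ x, η * ‖b x‖ ≤ δ) (p : P) (x : Ω) :
    ‖h p x - h p z₀ / h p₀ z₀ * h p₀ x‖ ≤ 4 * δ := by
  set s := h p z₀ / h p₀ z₀ with hs
  have hs1 : ‖s‖ ≤ 1 := by
    rw [hs, norm_div]; exact div_le_one_of_le₀ (hmax p z₀) (norm_nonneg _)
  have hsz : s * h p₀ z₀ = h p z₀ := div_mul_cancel₀ _ hne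
  have hbz : 0 < ‖b z₀‖ := by
    refine norm_pos_iff.2 fun h0 => hne ?_
    have := happrox p₀ z₀
    rw [h0, mul_zero, sub_zero, norm_zero, mul_zero] at this
    exact norm_le_zero_iff.1 this
  have hdiff : ∀ y, ‖(h p y - a p * b y) - s * (h p₀ y - a p₀ * b y)‖ ≤ 2 * (η * ‖b y‖) := by
    intro y
    have h₁ := norm_sub_le (h p y - a p * b y) (s * (h p₀ y - a p₀ * b y))
    have h₂ : ‖s * (h p₀ y - a p₀ * b y)‖ ≤ ‖h p₀ y - a p₀ * b y‖ := by
      rw [norm_mul]; exact mul_le_of_le_one_left (norm_nonneg _) hs1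
    linarith [happrox p y, happrox p₀ y]
  -- The one-step residual vanishes at `z₀`, which forces the coefficient of `b` to be small. The
  -- error relative to `‖b‖` lets `‖b z₀‖` cancel; an absolute error would leave the uncontrolled
  -- ratio `‖b x‖ / ‖b z₀‖`.
  have hv : ‖a p - s * a p₀‖ ≤ 2 * η := by
    have h₁ := hdiff z₀
    have e : (h p z₀ - a p * b z₀) - s * (h p₀ z₀ - a p₀ * b z₀) =
        -((a p - s * a p₀) * b z₀) := by linear_combination -hsz
    rw [e, norm_neg, norm_mul, ← mul_assoc] at h₁
    exact le_of_mul_le_mul_right h₁ hbz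
  have e : h p x - s * h p₀ x =
      ((h p x - a p * b x) - s * (h p₀ x - a p₀ * b x)) + (a p - s * a p₀) * b x := by ring
  rw [e]
  have h₁ := norm_add_le ((h p x - a p * b x) - s * (h p₀ x - a p₀ * b x))
    ((a p - s * a p₀) * b x)
  have h₂ : ‖(a p - s * a p₀) * b x‖ ≤ 2 * η * ‖b x‖ := by
    rw [norm_mul]; exact mul_le_mul_of_nonneg_right hv (norm_nonneg _)
  linarith [hdiff x, hb x]

/-- The greedy error after one step, for a family that is close to one function. -/
theorem norm_sub_div_mul_le_of_const {p₀ : P} {z₀ : Ω} (hmax : ∀ p x, ‖h p x‖ ≤ ‖h p₀ z₀‖)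
    (hne : h p₀ z₀ ≠ 0) {b : Ω → ℂ} {δ : ℝ} (happrox : ∀ p x, ‖h p x - b x‖ ≤ δ) (p : P) (x : Ω) :
    ‖h p x - h p z₀ / h p₀ z₀ * h p₀ x‖ ≤ 4 * δ := by
  set s := h p z₀ / h p₀ z₀ with hs
  have hsz : s * h p₀ z₀ = h p z₀ := div_mul_cancel₀ _ hne
  have hdiff : ∀ y, ‖h p y - h p₀ y‖ ≤ 2 * δ := by
    intro y
    have := norm_sub_le (h p y - b y) (h p₀ y - b y)
    rw [sub_sub_sub_cancel_right] at this
    linarith [happrox p y, happrox p₀ y]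
  have h₁ : ‖(s - 1) * h p₀ x‖ ≤ ‖h p z₀ - h p₀ z₀‖ := by
    rw [← hsz, ← sub_one_mul, norm_mul, norm_mul]
    exact mul_le_mul_of_nonneg_left (hmax _ _) (norm_nonneg _)
  have e : h p x - s * h p₀ x = (h p x - h p₀ x) - (s - 1) * h p₀ x := by ring
  rw [e]
  linarith [norm_sub_le (h p x - h p₀ x) ((s - 1) * h p₀ x), hdiff x, hdiff z₀]

theorem IsGreedyBasis.aestronglyMeasurable_magicSum {M : ℕ} {p : ℕ → P} {z : ℕ → Ω}
    {q : ℕ → Ω → ℂ} (H : IsGreedyBasis h M p z q) [MeasurableSpace Ω] {μ : Measure Ω}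
    (hm : ∀ p, AEStronglyMeasurable (h p) μ) (p' : P) :
    AEStronglyMeasurable (magicSum h z q M p') μ := by
  have hsum : ∀ N : ℕ, (∀ j < N, AEStronglyMeasurable (q j) μ) → ∀ p',
      AEStronglyMeasurable (magicSum h z q N p') μ := by
    intro N hN p'
    have : magicSum h z q N p' = fun x => _ := funext fun x => magicSum_eq_sum_mulVec p' x
    rw [this]
    exact Finset.aestronglyMeasurable_fun_sum _ fun j _ => (hN j j.2).const_mul _
  refine hsum M (fun j hj => ?_) p'
  induction j using Nat.strong_induction_on with
  | _ j ih =>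
    have : q j = fun x => (h (p j) x - magicSum h z q j (p j) x) *
        (magicResidual h z q j (p j) (z j))⁻¹ := funext fun x => H.eq_div j hj x
    rw [this]
    exact ((hm (p j)).sub (hsum j (fun i hi => ih i hi (hi.trans hj)) (p j))).mul_const _

theorem magicErrorBounds_of_lowRank {ϱ C : ℝ} (hϱ : 0 < ϱ) (hC : 0 ≤ C)
    (hbdd : ∃ K : ℝ, ∀ p x, ‖h p x‖ ≤ K)
    (happrox : ∀ M : ℕ, ∃ (a : ℕ → P → ℂ) (b : ℕ → Ω → ℂ), ∀ p x,
      ‖h p x - ∑ j ∈ Finset.range M, a j p * b j x‖ ≤ C * ϱ⁻¹ ^ M)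
    (hstep : ∀ p₀ z₀, (∀ p x, ‖h p x‖ ≤ ‖h p₀ z₀‖) → h p₀ z₀ ≠ 0 → ∀ p x,
      ‖h p x - h p z₀ / h p₀ z₀ * h p₀ x‖ ≤ 4 * (C * ϱ⁻¹)) : MagicErrorBounds h ϱ C := by
  classical
  intro M hM p z q hrun
  have hspec : HasIndependent h (magicSteps h M) :=
    Nat.findGreatest_spec (P := HasIndependent h) (Nat.zero_le M)
      ⟨Fin.elim0, linearIndependent_empty_type⟩
  have hle : magicSteps h M ≤ M := Nat.findGreatest_le M
  have H := IsGreedyBasis.of_isMagicRun hbdd hrun hle hspec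
  have hscale : (ϱ / 4) ^ (-(M : ℤ)) = 4 ^ M * ϱ⁻¹ ^ M := by
    rw [zpow_neg, zpow_natCast, ← inv_pow, inv_div, div_eq_mul_inv, mul_pow]
  have herr : ∀ (p' : P) (x : Ω),
      ‖h p' x - magicInterp h z q M p' x‖ ≤ C * M * (ϱ / 4) ^ (-(M : ℤ)) := by
    intro p' x
    change ‖magicResidual h z q (magicSteps h M) p' x‖ ≤ _
    rcases hle.lt_or_eq with hlt | heq
    -- Early stop: a nonzero residual would yield one more independent function, against the
    -- maximality of `magicSteps`.
    · have h0 : magicResidual h z q (magicSteps h M) p' x = 0 := by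
        by_contra hne
        exact Nat.findGreatest_is_greatest (Nat.lt_succ_self _) hlt (H.hasIndependent_succ hne)
      rw [h0, norm_zero]
      positivity
    · rw [heq] at H ⊢
      rw [hscale]
      -- The general comparison would give `8 * C * ϱ⁻¹` for `M = 1`, twice what is allowed; hence
      -- `hstep`.
      rcases hM.eq_or_lt with rfl | hM
      · have hmax := H.max 0 one_pos
        have hne := H.ne_zero 0 one_pos
        simp only [magicResidual_zero] at hmax hne
        rw [H.residual_succ one_pos, H.eq_div 0 one_pos]
        simp only [magicResidual_zero]
        rw [mul_div_assoc', mul_div_right_comm]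
        refine (hstep _ _ hmax hne p' x).trans_eq ?_
        push_cast
        ring
      · obtain ⟨a, b, hab⟩ := happrox M
        have hM2 : (2 : ℝ) ≤ M := by exact_mod_cast hM
        refine (H.norm_residual_le hab p' x).trans ?_
        have : 0 ≤ 4 ^ M * (C * ϱ⁻¹ ^ M) := by positivity
        nlinarith
  refine ⟨herr, fun _ μ hμ hmeas p' => ?_⟩
  obtain ⟨K, hK⟩ := hbdd
  have h₁ : Integrable (h p') μ := Integrable.of_bound (hmeas p') K (ae_of_all _ (hK p'))
  have h₂ : Integrable (magicInterp h z q M p') μ := by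
    refine Integrable.of_bound (H.aestronglyMeasurable_magicSum hmeas p')
      (K + C * M * (ϱ / 4) ^ (-(M : ℤ))) (ae_of_all _ fun x => ?_)
    have e : magicInterp h z q M p' x = h p' x - (h p' x - magicInterp h z q M p' x) := by ring
    rw [e]
    exact (norm_sub_le _ _).trans (add_le_add (hK p' x) (herr p' x))
  refine ⟨h₁, h₂, ?_⟩
  rw [← integral_sub h₁ h₂]
  refine (norm_integral_le_of_norm_le_const (ae_of_all _ (herr p'))).trans_eq ?_
  ring

end ErrorBounds

/-! ### Bernstein ellipses of sets of reals -/

theorem bernsteinTransform_eq (b₁ b₂ : ℝ) (w : ℂ) :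
    bernsteinTransform b₁ b₂ w = (b₁ + b₂) / 2 + (b₂ - b₁) / 2 * w := by
  conv_rhs => rw [← Complex.re_add_im w]
  rw [bernsteinTransform]
  ring

/-- If `sInf S = sSup S`, the ellipse collapses to a point with empty interior and `hF` says
nothing, but the composite is then constant. -/
theorem differentiableOn_comp_bernsteinTransform {S : Set ℝ} {ϱ : ℝ} {F : ℂ → ℂ}
    (hS : sInf S ≤ sSup S) (hF : AnalyticOnNhd ℂ F (interior (bernsteinEllipse S ϱ))) :
    DifferentiableOn ℂ (fun w => F (bernsteinTransform (sInf S) (sSup S) w))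
      (stdBernsteinEllipse ϱ) := by
  have he : bernsteinTransform (sInf S) (sSup S) =
      fun w => (((sInf S : ℝ) : ℂ) + (sSup S : ℝ)) / 2 +
        (((sSup S : ℝ) : ℂ) - (sInf S : ℝ)) / 2 * w :=
    funext fun w => bernsteinTransform_eq _ _ w
  rcases hS.eq_or_lt with heq | hlt
  · have : (fun w => F (bernsteinTransform (sInf S) (sSup S) w)) = fun _ => F (sInf S : ℝ) := by
      funext w
      rw [bernsteinTransform_eq, ← heq, sub_self, zero_div, zero_mul, add_zero, add_self_div_two]
    rw [this]
    exact differentiableOn_const _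
  · have hc : (((sSup S : ℝ) : ℂ) - (sInf S : ℝ)) / 2 ≠ 0 := by
      rw [← Complex.ofReal_sub]
      exact div_ne_zero (Complex.ofReal_ne_zero.2 (sub_pos.2 hlt).ne') two_ne_zero
    have hopen : IsOpen (bernsteinEllipse S ϱ) := by
      have : IsOpenMap (bernsteinTransform (sInf S) (sSup S)) := by
        rw [he]
        exact (isOpenMap_add_left _).comp (Homeomorph.mulLeft₀ _ hc).isOpenMap
      exact this _ (isOpen_stdBernsteinEllipse ϱ)
    intro w hw
    have hFw := (hF (bernsteinTransform (sInf S) (sSup S) w)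
      (by rw [hopen.interior_eq]; exact ⟨w, hw, rfl⟩)).differentiableAt
    have hτ : DifferentiableAt ℂ (bernsteinTransform (sInf S) (sSup S)) w := by
      rw [he]; fun_prop
    exact (hFw.comp w hτ).differentiableWithinAt

theorem exists_cos_bernsteinTransform {S : Set ℝ} (hS : IsCompact S) {s : ℝ} (hs : s ∈ S) :
    ∃ t : ℝ, bernsteinTransform (sInf S) (sSup S) (Real.cos t) = s := by
  have h₁ : sInf S ≤ s := csInf_le hS.bddBelow hs
  have h₂ : s ≤ sSup S := le_csSup hS.bddAbove hs
  have hτ : ∀ v : ℝ, (sInf S + sSup S) / 2 + (sSup S - sInf S) / 2 * v = s →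
      bernsteinTransform (sInf S) (sSup S) v = s := by
    intro v hv
    rw [bernsteinTransform_eq, ← hv]
    push_cast
    ring
  rcases (h₁.trans h₂).eq_or_lt with heq | hlt
  · exact ⟨0, hτ _ (by rw [← heq, sub_self]; linarith)⟩
  · have hd : 0 < sSup S - sInf S := sub_pos.2 hlt
    refine ⟨Real.arccos ((2 * s - (sInf S + sSup S)) / (sSup S - sInf S)), hτ _ ?_⟩
    rw [Real.cos_arccos]
    · field_simp; ring
    · rw [le_div_iff₀ hd]; linarith
    · rw [div_le_one hd]; linarith

/-- Uniform polynomial (Chebyshev) approximation on a compact set of reals of a function that is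
analytic and bounded in the Bernstein ellipse of the set. -/
theorem norm_sub_chebyshev_sum_bernstein_le {S : Set ℝ} {ϱ K : ℝ} {F : ℂ → ℂ} (hϱ : 1 < ϱ)
    (hS : sInf S ≤ sSup S) (hF : AnalyticOnNhd ℂ F (interior (bernsteinEllipse S ϱ)))
    (hK : ∀ w ∈ bernsteinEllipse S ϱ, ‖F w‖ ≤ K) {t s : ℝ}
    (hts : bernsteinTransform (sInf S) (sSup S) (Real.cos t) = s) (M : ℕ) :
    ‖F s - ∑ k ∈ Finset.range M,
      chebyshevCoeff (fun w => F (bernsteinTransform (sInf S) (sSup S) w)) k *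
        Complex.cos (k * t)‖ ≤ 2 * ϱ / (ϱ - 1) * K * ϱ⁻¹ ^ M := by
  have := norm_sub_chebyshev_sum_le hϱ (differentiableOn_comp_bernsteinTransform hS hF)
    (fun w hw => hK _ ⟨w, hw, rfl⟩) M t
  simpa only [hts] using this

/-! ### The main theorem -/

/-- A bound for a product of two functions from the supremum of each, where the product is
nonzero somewhere. -/
theorem exists_bounds_of_mul_lt_top {A B : Type*} {g₁ : A → ℂ} {g₂ : B → ℂ} {s₁ s₂ : ℝ≥0∞}
    (h₁ : ∀ a, ‖g₁ a‖ₑ ≤ s₁) (h₂ : ∀ b, ‖g₂ b‖ₑ ≤ s₂) (hfin : s₁ * s₂ < ∞) {a₀ : A} {b₀ : B}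
    (hne : g₁ a₀ * g₂ b₀ ≠ 0) :
    0 < s₁.toReal ∧ 0 < s₂.toReal ∧ (∀ a, ‖g₁ a‖ ≤ s₁.toReal) ∧ ∀ b, ‖g₂ b‖ ≤ s₂.toReal := by
  -- Since `0 * ∞ = 0` in `ℝ≥0∞`, a finite product bounds both factors only once neither is zero.
  have p₁ : s₁ ≠ 0 := fun h0 => left_ne_zero_of_mul hne (by simpa [h0] using h₁ a₀)
  have p₂ : s₂ ≠ 0 := fun h0 => right_ne_zero_of_mul hne (by simpa [h0] using h₂ b₀)
  have t₁ : s₁ ≠ ∞ := fun h0 => by rw [h0, ENNReal.top_mul p₂] at hfin; exact lt_irrefl _ hfin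
  have t₂ : s₂ ≠ ∞ := fun h0 => by rw [h0, ENNReal.mul_top p₁] at hfin; exact lt_irrefl _ hfin
  refine ⟨ENNReal.toReal_pos p₁ t₁, ENNReal.toReal_pos p₂ t₂, fun a => ?_, fun b => ?_⟩
  · rw [← toReal_enorm]; exact ENNReal.toReal_mono t₁ (h₁ a)
  · rw [← toReal_enorm]; exact ENNReal.toReal_mono t₂ (h₂ b)

theorem magicErrorBounds_second {P : Type*} [TopologicalSpace P] {Ω : Set ℝ} {h : P → Ω → ℂ}
    {ϱ : ℝ} (hϱ : 1 < ϱ) (hh : MagicAssumptions h) {f₁ : P → ℂ → ℂ} {f₂ : Ω → ℂ}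
    (hf : AnalyticFactorizationSecond h (bernsteinEllipse Ω ϱ) f₁ f₂) {C : ℝ}
    (hC : C = magicConst ϱ (⨆ p : P, ⨆ w ∈ bernsteinEllipse Ω ϱ, ‖f₁ p w‖ₑ) (⨆ x : Ω, ‖f₂ x‖ₑ)) :
    0 < C ∧ MagicErrorBounds h ϱ C := by
  have hϱ0 : 0 < ϱ := by linarith
  have hϱ1 : 0 < ϱ - 1 := by linarith
  obtain ⟨p₀, x₀, h0⟩ := hh.nonzero
  rw [hf.factor] at h0
  obtain ⟨hk₁, hk₂, b₁, b₂⟩ := exists_bounds_of_mul_lt_top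
    (g₁ := fun a : P × bernsteinEllipse Ω ϱ => f₁ a.1 a.2) (g₂ := f₂)
    (fun a => le_iSup_of_le a.1 (le_iSup₂ (f := fun w _ => ‖f₁ a.1 w‖ₑ) (a.2 : ℂ) a.2.2))
    (fun x => le_iSup (fun x => ‖f₂ x‖ₑ) x) hf.finite
    (a₀ := (p₀, ⟨_, hf.subset x₀⟩)) (b₀ := x₀) h0
  rw [magicConst, ENNReal.toReal_mul] at hC
  set k₁ := (⨆ p : P, ⨆ w ∈ bernsteinEllipse Ω ϱ, ‖f₁ p w‖ₑ).toReal
  set k₂ := (⨆ x : Ω, ‖f₂ x‖ₑ).toReal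
  have hCpos : 0 < C := by rw [hC]; positivity
  have hcomp : IsCompact Ω := isCompact_iff_compactSpace.2 hh.compact_domain
  have hle : sInf Ω ≤ sSup Ω :=
    (csInf_le hcomp.bddBelow x₀.2).trans (le_csSup hcomp.bddAbove x₀.2)
  choose t ht using fun x : Ω => exists_cos_bernsteinTransform hcomp x.2
  let a : ℕ → P → ℂ := fun k p =>
    chebyshevCoeff (fun w => f₁ p (bernsteinTransform (sInf Ω) (sSup Ω) w)) k
  let b : ℕ → Ω → ℂ := fun k x => Complex.cos (k * t x) * f₂ x
  -- The factor `‖f₂ x‖` is kept pointwise, as the case `M = 1` needs a relative error.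
  have hrel : ∀ (M : ℕ) p x, ‖h p x - ∑ j ∈ Finset.range M, a j p * b j x‖ ≤
      2 * ϱ / (ϱ - 1) * k₁ * ϱ⁻¹ ^ M * ‖f₂ x‖ := by
    intro M p x
    have := norm_sub_chebyshev_sum_bernstein_le hϱ hle (hf.analytic p)
      (fun w hw => b₁ (p, ⟨w, hw⟩)) (ht x) M
    have e : h p x - ∑ j ∈ Finset.range M, a j p * b j x =
        (f₁ p ((x : ℝ) : ℂ) - ∑ k ∈ Finset.range M, a k p * Complex.cos (k * t x)) * f₂ x := by
      rw [hf.factor, sub_mul, Finset.sum_mul]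
      simp only [b, mul_assoc]
    rw [e, norm_mul]
    exact mul_le_mul_of_nonneg_right this (norm_nonneg _)
  have hrel' : ∀ (M : ℕ) x, 2 * ϱ / (ϱ - 1) * k₁ * ϱ⁻¹ ^ M * ‖f₂ x‖ ≤ C * ϱ⁻¹ ^ M := by
    intro M x
    calc _ ≤ 2 * ϱ / (ϱ - 1) * k₁ * ϱ⁻¹ ^ M * k₂ := by gcongr; exact b₂ x
      _ = C * ϱ⁻¹ ^ M := by rw [hC]; ring
  refine ⟨hCpos, magicErrorBounds_of_lowRank hϱ0 hCpos.le hh.bounded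
    (fun M => ⟨a, b, fun p x => (hrel M p x).trans (hrel' M x)⟩) ?_⟩
  intro p₁ z₁ hmax hne
  -- The zeroth Chebyshev polynomial is `1`, so the rank-one approximant is a multiple of `f₂`.
  refine norm_sub_div_mul_le_of_relative (a := a 0) (b := f₂)
    (η := 2 * ϱ / (ϱ - 1) * k₁ * ϱ⁻¹ ^ 1) hmax hne (fun p x => ?_) fun x => ?_
  · simpa [b] using hrel 1 p x
  · simpa using hrel' 1 x

theorem magicErrorBounds_first {Ω : Type*} [TopologicalSpace Ω] {P : Set ℝ} {h : P → Ω → ℂ}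
    {ϱ : ℝ} (hϱ : 1 < ϱ) (hh : MagicAssumptions h) {f₁ : ℂ → Ω → ℂ} {f₂ : Ω → ℂ}
    (hf : AnalyticFactorizationFirst h (bernsteinEllipse P ϱ) f₁ f₂) {C : ℝ}
    (hC : C = magicConst ϱ (⨆ w ∈ bernsteinEllipse P ϱ, ⨆ x : Ω, ‖f₁ w x‖ₑ) (⨆ x : Ω, ‖f₂ x‖ₑ)) :
    0 < C ∧ MagicErrorBounds h ϱ C := by
  have hϱ0 : 0 < ϱ := by linarith
  have hϱ1 : 0 < ϱ - 1 := by linarith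
  obtain ⟨p₀, x₀, h0⟩ := hh.nonzero
  rw [hf.factor] at h0
  obtain ⟨hk₁, hk₂, b₁, b₂⟩ := exists_bounds_of_mul_lt_top
    (g₁ := fun a : bernsteinEllipse P ϱ × Ω => f₁ a.1 a.2) (g₂ := f₂)
    (fun a => le_iSup₂_of_le (a.1 : ℂ) a.1.2 (le_iSup (fun x => ‖f₁ a.1 x‖ₑ) a.2))
    (fun x => le_iSup (fun x => ‖f₂ x‖ₑ) x) hf.finite
    (a₀ := (⟨_, hf.subset p₀⟩, x₀)) (b₀ := x₀) h0
  rw [magicConst, ENNReal.toReal_mul] at hC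
  set k₁ := (⨆ w ∈ bernsteinEllipse P ϱ, ⨆ x : Ω, ‖f₁ w x‖ₑ).toReal
  set k₂ := (⨆ x : Ω, ‖f₂ x‖ₑ).toReal
  have hCpos : 0 < C := by rw [hC]; positivity
  have hcomp : IsCompact P := isCompact_iff_compactSpace.2 hh.compact_param
  have hle : sInf P ≤ sSup P :=
    (csInf_le hcomp.bddBelow p₀.2).trans (le_csSup hcomp.bddAbove p₀.2)
  choose t ht using fun p : P => exists_cos_bernsteinTransform hcomp p.2
  let a : ℕ → P → ℂ := fun k p => Complex.cos (k * t p)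
  let b : ℕ → Ω → ℂ := fun k x =>
    chebyshevCoeff (fun w => f₁ (bernsteinTransform (sInf P) (sSup P) w) x) k * f₂ x
  have happrox : ∀ (M : ℕ) p x, ‖h p x - ∑ j ∈ Finset.range M, a j p * b j x‖ ≤
      C * ϱ⁻¹ ^ M := by
    intro M p x
    have := norm_sub_chebyshev_sum_bernstein_le (F := fun w => f₁ w x) hϱ hle (hf.analytic x)
      (fun w hw => b₁ (⟨w, hw⟩, x)) (ht p) M
    have e : h p x - ∑ j ∈ Finset.range M, a j p * b j x =
        (f₁ ((p : ℝ) : ℂ) x - ∑ k ∈ Finset.range M,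
          chebyshevCoeff (fun w => f₁ (bernsteinTransform (sInf P) (sSup P) w) x) k *
            Complex.cos (k * t p)) * f₂ x := by
      rw [hf.factor, sub_mul, Finset.sum_mul]
      congr 1
      exact Finset.sum_congr rfl fun j _ => by simp only [a, b]; ring
    rw [e, norm_mul]
    calc _ ≤ 2 * ϱ / (ϱ - 1) * k₁ * ϱ⁻¹ ^ M * k₂ :=
          mul_le_mul this (b₂ x) (norm_nonneg _) (by positivity)
      _ = C * ϱ⁻¹ ^ M := by rw [hC]; ring
  refine ⟨hCpos, magicErrorBounds_of_lowRank hϱ0 hCpos.le hh.bounded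
    (fun M => ⟨a, b, happrox M⟩) ?_⟩
  intro p₁ z₁ hmax hne
  -- Here the zeroth Chebyshev polynomial is the factor in `p`, so the rank-one approximant does not
  -- depend on the parameter.
  refine norm_sub_div_mul_le_of_const (b := b 0) hmax hne fun p x => ?_
  simpa [a] using happrox 1 p x

theorem mainTheorem1 (ϱ : ℝ) (hϱ : 4 < ϱ) :
    (∀ (P : Type*) [MetricSpace P] (Ω : Set ℝ) (h : P → Ω → ℂ), MagicAssumptions h →
      ∀ (f₁ : P → ℂ → ℂ) (f₂ : Ω → ℂ),
        AnalyticFactorizationSecond h (bernsteinEllipse Ω ϱ) f₁ f₂ →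
        ∃ C : ℝ, 0 < C ∧
          C = magicConst ϱ (⨆ p : P, ⨆ w ∈ bernsteinEllipse Ω ϱ, ‖f₁ p w‖ₑ) (⨆ x : Ω, ‖f₂ x‖ₑ) ∧
          MagicErrorBounds h ϱ C) ∧
    (∀ (d : ℕ) (P : Set ℝ) (Ω : Set (Fin d → ℂ)) (h : P → Ω → ℂ), MagicAssumptions h →
      ∀ (f₁ : ℂ → Ω → ℂ) (f₂ : Ω → ℂ),
        AnalyticFactorizationFirst h (bernsteinEllipse P ϱ) f₁ f₂ →
        ∃ C : ℝ, 0 < C ∧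
          C = magicConst ϱ (⨆ w ∈ bernsteinEllipse P ϱ, ⨆ x : Ω, ‖f₁ w x‖ₑ) (⨆ x : Ω, ‖f₂ x‖ₑ) ∧
          MagicErrorBounds h ϱ C) := by
  have hϱ' : 1 < ϱ := by linarith
  refine ⟨fun P _ Ω h hh f₁ f₂ hf => ?_, fun d P Ω h hh f₁ f₂ hf => ?_⟩
  · have := magicErrorBounds_second hϱ' hh hf rfl
    exact ⟨_, this.1, rfl, this.2⟩
  · have := magicErrorBounds_first hϱ' hh hf rfl
    exact ⟨_, this.1, rfl, this.2⟩
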